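/- Let $\Bbbk$ be a field of characteristic zero and $\Omega$ a set. Let $\mathrm{Alg}$ be the class of all linear spaces over $\Bbbk$ with bilinear operations $\circ_\omega$, $\omega\in\Omega$; a dialgebra is a linear space over $\Bbbk$ with bilinear operations $\vdash_\omega,\dashv_\omega$, $\omega\in\Omega$. A variety is the class of all algebras (of a given signature) that satisfy some set of polynomial identities, and the variety generated by a class of algebras consists of all algebras that satisfy all the identities holding on every member of the class. A $\mathrm{Perm}$-algebra is an associative algebra $P$ with the identity $(xy-yx)z=0$; for $A\in\mathrm{Alg}$, the dialgebra $P\otimes A$ has the operations $$(p\otimes a)\vdash_\omega(q\otimes b)=pq\otimes (a\circ_\omega b),\qquad (p\otimes a)\dashv_\omega(q\otimes b)=qp\otimes (a\circ_\omega b).$$ For a variety $\mathfrak M\subseteq\mathrm{Alg}$, let $\mathrm{di}\text{-}\mathfrak M$ be the variety of dialgebras generated by all $P\otimes A$ with $P\in\mathrm{Perm}$ and $A\in\mathfrak M$. A pre-commutative algebra is an algebra $Z$ with one bilinear product satisfying $(xy+yx)z=x(yz)$; for a dialgebra $A$, the algebra $Z\boxtimes A\in\mathrm{Alg}$ is the space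 $Z\otimes A$ with the operations $$(z\otimes a)\circ_\omega(w\otimes b)=zw\otimes (a\vdash_\omega b)+wz\otimes (a\dashv_\omega b).$$ For a variety $\mathfrak V$ of dialgebras, let $\widehat{\mathfrak V}\subseteq \mathrm{Alg}$ be the variety generated by all $Z\boxtimes A$ with $Z$ pre-commutative and $A\in\mathfrak V$. Let $\mathfrak V$ be a variety of dialgebras all of whose members satisfy the identities $$(x\vdash_\omega y-x\dashv_\omega y)\vdash_\mu z=0,\qquad x\dashv_\mu(y\vdash_\omega z-y\dashv_\omega z)=0\qquad(\omega,\mu\in\Omega).$$ Then $\widehat{\mathfrak V}$ is the least of all varieties $\mathfrak M\subseteq\mathrm{Alg}$ such that $\mathfrak V\subseteq\mathrm{di}\text{-}\mathfrak M$: that is, $\mathfrak V\subseteq\mathrm{di}\text{-}\widehat{\mathfrak V}$, and $\widehat{\mathfrak V}\subseteq\mathfrak M$ for every variety $\mathfrak M\subseteq\mathrm{Alg}$ with $\mathfrak V\subseteq\mathrm{di}\text{-}\mathfrak M$. -/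

import Mathlib

open scoped TensorProduct

universe u v w

/-- An algebra over `k`: a linear space with a family of bilinear operations indexed by `Ω`. -/
structure OmegaAlgebra (k : Type u) [Field k] (Ω : Type v) where
  carrier : Type w
  [addCommGroup : AddCommGroup carrier]
  [module : Module k carrier]
  op : Ω → carrier →ₗ[k] carrier →ₗ[k] carrier

namespace OmegaAlgebra

attribute [instance] OmegaAlgebra.addCommGroup OmegaAlgebra.module

/-- Nonassociative monomials in the variables `x₀, x₁, …` with respect to the operations `Ω`. -/
inductive Monomial (Ω : Type v) : Type v where
  | var (n : ℕ) : Monomial Ω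
  | op (ω : Ω) (s t : Monomial Ω) : Monomial Ω

/-- The value of a monomial in an algebra after the substitution `xₙ ↦ x n`. -/
def Monomial.eval {k : Type u} [Field k] {Ω : Type v} (A : OmegaAlgebra.{u, v, w} k Ω)
    (x : ℕ → A.carrier) : Monomial Ω → A.carrier
  | .var n => x n
  | .op ω s t => A.op ω (s.eval A x) (t.eval A x)

/-- Elements of the free algebra on countably many generators: linear combinations of monomials. -/
abbrev Poly (k : Type u) [Field k] (Ω : Type v) : Type (max u v) := Monomial Ω →₀ k

/-- The value of a polynomial in an algebra after the substitution `xₙ ↦ x n`. -/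
noncomputable def polyEval {k : Type u} [Field k] {Ω : Type v} (A : OmegaAlgebra.{u, v, w} k Ω)
    (x : ℕ → A.carrier) : Poly k Ω →ₗ[k] A.carrier :=
  Finsupp.linearCombination k (fun m : Monomial Ω => m.eval A x)

/-- `f = 0` is an identity on the algebra `A`. -/
def Satisfies {k : Type u} [Field k] {Ω : Type v} (A : OmegaAlgebra.{u, v, w} k Ω)
    (f : Poly k Ω) : Prop :=
  ∀ x : ℕ → A.carrier, polyEval A x f = 0

/-- The class of all algebras satisfying all identities from `T`. -/
def models {k : Type u} [Field k] {Ω : Type v} (T : Set (Poly k Ω)) :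
    Set (OmegaAlgebra.{u, v, w} k Ω) :=
  {A | ∀ f ∈ T, A.Satisfies f}

/-- The set of all identities that hold on all algebras of the class `C`. -/
def identities {k : Type u} [Field k] {Ω : Type v} (C : Set (OmegaAlgebra.{u, v, w} k Ω)) :
    Set (Poly k Ω) :=
  {f | ∀ A ∈ C, A.Satisfies f}

/-- A variety is a class of algebras defined by a set of identities. -/
def IsVariety {k : Type u} [Field k] {Ω : Type v} (C : Set (OmegaAlgebra.{u, v, w} k Ω)) : Prop :=
  ∃ T : Set (Poly k Ω), C = models T

/-- The variety generated by a class of algebras. -/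
def Var {k : Type u} [Field k] {Ω : Type v} (C : Set (OmegaAlgebra.{u, v, w} k Ω)) :
    Set (OmegaAlgebra.{u, v, w} k Ω) :=
  models (identities C)

/-- The product of an algebra with one operation. -/
def mul {k : Type u} [Field k] (A : OmegaAlgebra.{u, 0, w} k Unit) :
    A.carrier →ₗ[k] A.carrier →ₗ[k] A.carrier :=
  A.op ()

/-- Perm-algebras: associative algebras with the identity `(x y - y x) z = 0`. -/
def IsPerm {k : Type u} [Field k] (P : OmegaAlgebra.{u, 0, w} k Unit) : Prop :=
  (∀ x y z : P.carrier, P.mul (P.mul x y) z = P.mul x (P.mul y z)) ∧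
    ∀ x y z : P.carrier, P.mul (P.mul x y - P.mul y x) z = 0

/-- Pre-commutative (Zinbiel) algebras, with one product: `(x y + y x) z = x (y z)`. -/
def IsPreCom {k : Type u} [Field k] (Z : OmegaAlgebra.{u, 0, w} k Unit) : Prop :=
  ∀ x y z : Z.carrier, Z.mul (Z.mul x y + Z.mul y x) z = Z.mul x (Z.mul y z)

/-- Algebras with the doubled family of operations: `Sum.inl ω` is the index of `⊢_ω`,
and `Sum.inr ω` is the index of `⊣_ω`. -/
abbrev Dialgebra (k : Type u) [Field k] (Ω : Type v) : Type (max u v (w + 1)) :=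
  OmegaAlgebra.{u, v, w} k (Ω ⊕ Ω)

/-- The operation `⊢_ω` of a dialgebra. -/
def vdash {k : Type u} [Field k] {Ω : Type v} (D : Dialgebra.{u, v, w} k Ω) (ω : Ω) :
    D.carrier →ₗ[k] D.carrier →ₗ[k] D.carrier :=
  D.op (Sum.inl ω)

/-- The operation `⊣_ω` of a dialgebra. -/
def dashv {k : Type u} [Field k] {Ω : Type v} (D : Dialgebra.{u, v, w} k Ω) (ω : Ω) :
    D.carrier →ₗ[k] D.carrier →ₗ[k] D.carrier :=
  D.op (Sum.inr ω)

/-- The dialgebra `P ⊗ A`: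
`(p ⊗ a) ⊢_ω (q ⊗ b) = p q ⊗ (a ∘_ω b)` and `(p ⊗ a) ⊣_ω (q ⊗ b) = q p ⊗ (a ∘_ω b)`. -/
noncomputable def permTensor {k : Type u} [Field k] {Ω : Type v}
    (P : OmegaAlgebra.{u, 0, w} k Unit) (A : OmegaAlgebra.{u, v, w} k Ω) :
    Dialgebra.{u, v, w} k Ω where
  carrier := P.carrier ⊗[k] A.carrier
  op
    | Sum.inl ω => TensorProduct.map₂ P.mul (A.op ω)
    | Sum.inr ω => TensorProduct.map₂ P.mul.flip (A.op ω)

/-- The algebra `Z ⊠ D`: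
`(z ⊗ a) ∘_ω (y ⊗ b) = z y ⊗ (a ⊢_ω b) + y z ⊗ (a ⊣_ω b)`. -/
noncomputable def boxTensor {k : Type u} [Field k] {Ω : Type v}
    (Z : OmegaAlgebra.{u, 0, w} k Unit) (D : Dialgebra.{u, v, w} k Ω) :
    OmegaAlgebra.{u, v, w} k Ω where
  carrier := Z.carrier ⊗[k] D.carrier
  op ω := TensorProduct.map₂ Z.mul (D.vdash ω) + TensorProduct.map₂ Z.mul.flip (D.dashv ω)

/-- The variety `di-𝔐` generated by all dialgebras `P ⊗ A` with `P` in `Perm` and `A` in `𝔐`. -/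
def di {k : Type u} [Field k] {Ω : Type v} (M : Set (OmegaAlgebra.{u, v, w} k Ω)) :
    Set (Dialgebra.{u, v, w} k Ω) :=
  Var {D | ∃ (P : OmegaAlgebra.{u, 0, w} k Unit) (A : OmegaAlgebra.{u, v, w} k Ω),
    P.IsPerm ∧ A ∈ M ∧ D = permTensor P A}

/-- The variety `di-Alg₀` of all dialgebras satisfying the identities
`(x ⊢_ω y - x ⊣_ω y) ⊢_μ z = 0` and `x ⊣_μ (y ⊢_ω z - y ⊣_ω z) = 0`. -/
def diAlg₀ (k : Type u) [Field k] (Ω : Type v) : Set (Dialgebra.{u, v, w} k Ω) :=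
  {D | ∀ (ω μ : Ω) (x y z : D.carrier),
    D.vdash μ (D.vdash ω x y - D.dashv ω x y) z = 0 ∧
      D.dashv μ x (D.vdash ω y z - D.dashv ω y z) = 0}

/-- The variety of algebras generated by all `Z ⊠ A` with `Z` pre-commutative and `A` in `𝔙`. -/
def hat {k : Type u} [Field k] {Ω : Type v} (V : Set (Dialgebra.{u, v, w} k Ω)) :
    Set (OmegaAlgebra.{u, v, w} k Ω) :=
  Var {B | ∃ (Z : OmegaAlgebra.{u, 0, w} k Unit) (A : Dialgebra.{u, v, w} k Ω),
    Z.IsPreCom ∧ A ∈ V ∧ B = boxTensor Z A}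

end OmegaAlgebra

-- Minimality: for `B` in `M`, the space `Z ⊠ (P ⊗ B)` is `(Z ⊗ P) ⊗ B`, where `Z ⊗ P` with product
-- `zy ⊗ pq + yz ⊗ qp` is associative and commutative (`antiTensorMul_assoc`). It is thus a scalar
-- extension of `B`, and over an infinite field this keeps every identity
-- (`Satisfies.boxTensor_permTensor`). Evaluating in `Z ⊗ F`, with `F` the free dialgebra, carries
-- this from the generators `P ⊗ B` to all of `di M` (`Satisfies.boxTensor_of_mem_Var`).
--
-- Membership: it suffices that, for fixed `P` and `Z`, each identity of `P ⊗ (Z ⊠ D)` holds on `D`.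
-- Take `P` with `pq = ε(p)q` and `Z = k[X]` with `fg = (∫f)g`. Let `I` be the integral over
-- `[0,1]`, `E` the value at `1`, and `δ` a second functional on `P` with `δ(pq) = ε(p)δ(q)`. For
-- suitable arguments the contraction by `δ ⊗ E` sends the value of every monomial to its value in
-- `D` (`contract_monomial_eval`). It is not a homomorphism; the induction works because the assumed
-- identities make the errors vanish in the places where they occur.

universe w₁ w₂

/-! ### Identities under linear maps, and functionals on tensor products. -/

namespace OmegaAlgebra

/-- Stated for compatibility on monomials at one substitution, so that it also covers a contraction
that is not a homomorphism. -/
theorem map_polyEval_of_monomial {k : Type u} [Field k] {Ω : Type v}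
    {A : OmegaAlgebra.{u, v, w₁} k Ω} {B : OmegaAlgebra.{u, v, w₂} k Ω}
    (φ : A.carrier →ₗ[k] B.carrier) {x : ℕ → A.carrier} {y : ℕ → B.carrier} (h : ∀ m : Monomial Ω, φ (m.eval A x) = m.eval B y) (f : Poly k Ω) :
    φ (polyEval A x f) = polyEval B y f := by
  simp only [polyEval, Finsupp.linearCombination_apply, Finsupp.sum, map_sum, map_smul, h]

/-- A linear map commuting with the operations commutes with the evaluation of polynomials. -/
theorem map_polyEval {k : Type u} [Field k] {Ω : Type v} {A : OmegaAlgebra.{u, v, w₁} k Ω}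
    {B : OmegaAlgebra.{u, v, w₂} k Ω} (φ : A.carrier →ₗ[k] B.carrier)
    (hφ : ∀ ω a b, φ (A.op ω a b) = B.op ω (φ a) (φ b)) (x : ℕ → A.carrier) (f : Poly k Ω) :
    φ (polyEval A x f) = polyEval B (fun n => φ (x n)) f := by
  refine map_polyEval_of_monomial φ (fun m => ?_) f
  induction m with
  | var n => rfl
  | op ω s t hs ht => simp only [Monomial.eval, hφ, hs, ht]

theorem Satisfies.of_injective {k : Type u} [Field k] {Ω : Type v} {A : OmegaAlgebra.{u, v, w₁} k Ω}
    {B : OmegaAlgebra.{u, v, w₂} k Ω} {f : Poly k Ω} (hB : B.Satisfies f)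
    (φ : A.carrier →ₗ[k] B.carrier) (hφ : ∀ ω a b, φ (A.op ω a b) = B.op ω (φ a) (φ b))
    (hinj : Function.Injective φ) : A.Satisfies f := fun x =>
  hinj (by rw [map_polyEval φ hφ, hB, map_zero])

theorem Satisfies.of_surjective {k : Type u} [Field k] {Ω : Type v}
    {A : OmegaAlgebra.{u, v, w₁} k Ω}
    {B : OmegaAlgebra.{u, v, w₂} k Ω} {f : Poly k Ω} (hA : A.Satisfies f)
    (φ : A.carrier →ₗ[k] B.carrier) (hφ : ∀ ω a b, φ (A.op ω a b) = B.op ω (φ a) (φ b))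
    (hsurj : Function.Surjective φ) : B.Satisfies f := fun x => by
  choose y hy using fun n => hsurj (x n)
  have := map_polyEval φ hφ y f
  simp only [hy] at this
  rw [← this, hA, map_zero]

/-- Functionals on the left factor separate the elements of a tensor product. -/
theorem tensor_eq_zero_of_forall_dual {k : Type u} [Field k] {M : Type w₁} {N : Type w₂}
    [AddCommGroup M] [AddCommGroup N] [Module k M] [Module k N] (t : M ⊗[k] N)
    (h : ∀ φ : M →ₗ[k] k, TensorProduct.lid k N (φ.rTensor N t) = 0) : t = 0 := by
  classical
  let b := Module.Basis.ofVectorSpace k M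
  apply (TensorProduct.equivFinsuppOfBasisLeft (N := N) b).injective
  rw [map_zero]
  ext i
  rw [TensorProduct.equivFinsuppOfBasisLeft_apply, Finsupp.zero_apply]
  exact h (b.coord i)

/-- Functionals on the right factor separate the elements of a tensor product. -/
theorem tensor_eq_zero_of_forall_dual_right {k : Type u} [Field k] {M : Type w₁} {N : Type w₂}
    [AddCommGroup M] [AddCommGroup N] [Module k M] [Module k N] (t : M ⊗[k] N)
    (h : ∀ φ : N →ₗ[k] k, TensorProduct.rid k M (φ.lTensor M t) = 0) : t = 0 := by
  classical
  let b := Module.Basis.ofVectorSpace k N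
  apply (TensorProduct.equivFinsuppOfBasisRight (M := M) b).injective
  rw [map_zero]
  ext i
  rw [TensorProduct.equivFinsuppOfBasisRight_apply, Finsupp.zero_apply]
  exact h (b.coord i)

/-! ### Scalar extension over an infinite field. -/

/-- Extension of scalars to a commutative algebra `R`, seen as an algebra over `k`. -/
noncomputable def extendScalars {k : Type u} [Field k] {Ω : Type v} (R : Type w₁) [CommRing R]
    [Algebra k R] (B : OmegaAlgebra.{u, v, w₂} k Ω) : OmegaAlgebra.{u, v, max w₁ w₂} k Ω where
  carrier := R ⊗[k] B.carrier
  op ω := TensorProduct.map₂ (LinearMap.mul k R) (B.op ω)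

/-- Compatibility of a linear map on a tensor product with bilinear operations can be checked on
pure tensors. -/
theorem map_bilin_of_tmul {k : Type u} [Field k] {M : Type v} {N : Type w} {Y : Type w₁}
    [AddCommGroup M] [AddCommGroup N] [AddCommGroup Y] [Module k M] [Module k N] [Module k Y]
    (op : M ⊗[k] N →ₗ[k] M ⊗[k] N →ₗ[k] M ⊗[k] N) (op' : Y →ₗ[k] Y →ₗ[k] Y)
    (φ : M ⊗[k] N →ₗ[k] Y)
    (h : ∀ m n m' n', φ (op (m ⊗ₜ n) (m' ⊗ₜ n')) = op' (φ (m ⊗ₜ n)) (φ (m' ⊗ₜ n')))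
    (a b : M ⊗[k] N) : φ (op a b) = op' (φ a) (φ b) := by
  induction a with
  | zero => simp
  | add a a' ha ha' => simp only [map_add, LinearMap.add_apply, ha, ha']
  | tmul m n =>
    induction b with
    | zero => simp
    | add b b' hb hb' => simp only [map_add, hb, hb']
    | tmul m' n' => exact h m n m' n'

theorem extendScalars_map {k : Type u} [Field k] {Ω : Type v} {R : Type w} {S : Type w₁}
    [CommRing R] [Algebra k R] [CommRing S] [Algebra k S] (φ : R →ₐ[k] S)
    (B : OmegaAlgebra.{u, v, w₂} k Ω) (ω : Ω) (a b : (extendScalars R B).carrier) :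
    φ.toLinearMap.rTensor B.carrier ((extendScalars R B).op ω a b) =
      (extendScalars S B).op ω (φ.toLinearMap.rTensor B.carrier a)
        (φ.toLinearMap.rTensor B.carrier b) := by
  refine map_bilin_of_tmul (TensorProduct.map₂ (LinearMap.mul k R) (B.op ω))
    (TensorProduct.map₂ (LinearMap.mul k S) (B.op ω)) (φ.toLinearMap.rTensor B.carrier) ?_ a b
  intro r c s d
  simp [TensorProduct.map₂_apply_tmul]

/-- Extending the scalars to polynomials over an infinite field preserves identities. -/
theorem Satisfies.extendScalars_mvPolynomial {k : Type u} [Field k] [Infinite k] {Ω : Type v}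
    (σ : Type w₁) {B : OmegaAlgebra.{u, v, w₂} k Ω} {f : Poly k Ω} (hB : B.Satisfies f) :
    (extendScalars (MvPolynomial σ k) B).Satisfies f := by
  intro x
  set t : MvPolynomial σ k ⊗[k] B.carrier := polyEval (extendScalars (MvPolynomial σ k) B) x f
  change t = 0
  -- Specialising the polynomial variables at a point `c` is a homomorphism to `B`, so it kills `t`.
  have key (c : σ → k) :
      TensorProduct.lid k B.carrier ((MvPolynomial.aeval c).toLinearMap.rTensor B.carrier t) = 0 := by
    let φ : (extendScalars (MvPolynomial σ k) B).carrier →ₗ[k] B.carrier :=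
      (TensorProduct.lid k B.carrier).toLinearMap ∘ₗ
        (MvPolynomial.aeval (R := k) c).toLinearMap.rTensor B.carrier
    have hφ : ∀ ω a b, φ ((extendScalars (MvPolynomial σ k) B).op ω a b) =
        B.op ω (φ a) (φ b) := by
      intro ω a b
      have hlid := map_bilin_of_tmul (TensorProduct.map₂ (LinearMap.mul k k) (B.op ω)) (B.op ω)
        (TensorProduct.lid k B.carrier).toLinearMap (fun r c s d => by
          simp [TensorProduct.map₂_apply_tmul, mul_smul, smul_comm r s])
      exact (congrArg _ (extendScalars_map (MvPolynomial.aeval c) B ω a b)).trans (hlid _ _)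
    exact (map_polyEval φ hφ x f).trans (hB _)
  -- A functional on `B` turns `t` into a polynomial vanishing at every point, hence zero because
  -- `k` is infinite.
  refine tensor_eq_zero_of_forall_dual_right t fun φ => MvPolynomial.funext fun c => ?_
  have hcomm : ∀ s : MvPolynomial σ k ⊗[k] B.carrier,
      MvPolynomial.eval c (TensorProduct.rid k _ (φ.lTensor _ s)) =
        φ (TensorProduct.lid k B.carrier
          ((MvPolynomial.aeval c).toLinearMap.rTensor B.carrier s)) := by
    intro s
    induction s with
    | zero => simp
    | add s s' hs hs' => simp only [map_add, hs, hs']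
    | tmul p b => simp [MvPolynomial.smul_eval, mul_comm, MvPolynomial.aeval_eq_eval]
  rw [hcomm, key, map_zero, map_zero]

/-- Extending the scalars of an algebra over an infinite field preserves identities. -/
theorem Satisfies.extendScalars {k : Type u} [Field k] [Infinite k] {Ω : Type v}
    (R : Type w₁) [CommRing R] [Algebra k R] {B : OmegaAlgebra.{u, v, w₂} k Ω} {f : Poly k Ω}
    (hB : B.Satisfies f) : (extendScalars R B).Satisfies f :=
  -- `R` is a quotient of the polynomial algebra on its own elements.
  (hB.extendScalars_mvPolynomial R).of_surjective
    ((MvPolynomial.aeval (R := k) (id : R → R)).toLinearMap.rTensor B.carrier)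
    (extendScalars_map _ B)
    (LinearMap.rTensor_surjective _ fun r => ⟨MvPolynomial.X r, by simp⟩)

/-- Bilinear maps on a triple tensor product are determined by their values on pure tensors. -/
theorem bilin_ext_triple {k : Type u} [Field k] {M : Type v} {N : Type w} {L : Type w₁}
    {Y : Type w₂} [AddCommGroup M] [AddCommGroup N] [AddCommGroup L] [AddCommGroup Y]
    [Module k M] [Module k N] [Module k L] [Module k Y]
    {F G : M ⊗[k] (N ⊗[k] L) →ₗ[k] M ⊗[k] (N ⊗[k] L) →ₗ[k] Y}
    (h : ∀ m n l m' n' l', F (m ⊗ₜ (n ⊗ₜ l)) (m' ⊗ₜ (n' ⊗ₜ l')) =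
      G (m ⊗ₜ (n ⊗ₜ l)) (m' ⊗ₜ (n' ⊗ₜ l'))) : F = G := by
  ext m n l m' n' l'
  exact h m n l m' n' l'

/-! ### Pre-commutative tensor Perm is commutative and associative. -/

section PermZinbiel

variable {k : Type u} [Field k] (Z P : OmegaAlgebra.{u, 0, w} k Unit)

/-- The product `(z ⊗ p)(y ⊗ q) = z y ⊗ p q + y z ⊗ q p` on the tensor product. -/
noncomputable def antiTensorMul :
    Z.carrier ⊗[k] P.carrier →ₗ[k] Z.carrier ⊗[k] P.carrier →ₗ[k] Z.carrier ⊗[k] P.carrier :=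
  TensorProduct.map₂ Z.mul P.mul + TensorProduct.map₂ Z.mul.flip P.mul.flip

theorem antiTensorMul_tmul (z y : Z.carrier) (p q : P.carrier) :
    antiTensorMul Z P (z ⊗ₜ p) (y ⊗ₜ q) =
      Z.mul z y ⊗ₜ P.mul p q + Z.mul y z ⊗ₜ P.mul q p := by
  simp [antiTensorMul, TensorProduct.map₂_apply_tmul]

theorem antiTensorMul_comm (a b : Z.carrier ⊗[k] P.carrier) :
    antiTensorMul Z P a b = antiTensorMul Z P b a := by
  have : antiTensorMul Z P = (antiTensorMul Z P).flip := by
    ext z p y q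
    simp [antiTensorMul_tmul, add_comm]
  exact LinearMap.congr_fun₂ this a b

variable {Z P}

theorem IsPerm.mul_left_comm (hP : P.IsPerm) (p q r : P.carrier) :
    P.mul p (P.mul q r) = P.mul q (P.mul p r) := by
  have := hP.2 p q r
  rw [map_sub, LinearMap.sub_apply, sub_eq_zero, hP.1, hP.1] at this
  exact this

/-- The tensor product of a pre-commutative algebra and a Perm-algebra is associative and
commutative. -/
theorem antiTensorMul_assoc (hZ : Z.IsPreCom) (hP : P.IsPerm) (a b c : Z.carrier ⊗[k] P.carrier) :
    antiTensorMul Z P (antiTensorMul Z P a b) c = antiTensorMul Z P a (antiTensorMul Z P b c) := by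
  induction a with
  | zero => simp
  | add a a' ha ha' => simp only [map_add, LinearMap.add_apply, ha, ha']
  | tmul z p =>
  induction b with
  | zero => simp
  | add b b' hb hb' => simp only [map_add, LinearMap.add_apply, hb, hb']
  | tmul y q =>
  induction c with
  | zero => simp
  | add c c' hc hc' => simp only [map_add, hc, hc']
  | tmul x r =>
  -- These expand the right-nested products of `Z`. A triple product in `P` depends only on its last
  -- factor, so both sides reduce to three groups of terms.
  have h1 := hZ z y x
  have h2 := hZ x y z
  have h3 := hZ x z y
  have h4 := hZ z x y
  rw [map_add, LinearMap.add_apply] at h1 h2 h3 h4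
  simp only [antiTensorMul_tmul, map_add, LinearMap.add_apply, hP.1]
  rw [← h1, ← h2, ← h3, ← h4, hP.mul_left_comm q p r, hP.mul_left_comm r q p,
    hP.mul_left_comm r p q]
  simp only [TensorProduct.add_tmul]
  abel

/-- The associative commutative algebra with product `antiTensorMul`. -/
noncomputable abbrev antiTensorRing (hZ : Z.IsPreCom) (hP : P.IsPerm) :
    NonUnitalCommRing (Z.carrier ⊗[k] P.carrier) where
  mul a b := antiTensorMul Z P a b
  mul_assoc := antiTensorMul_assoc hZ hP
  mul_comm := antiTensorMul_comm Z P
  left_distrib _ b c := map_add _ b c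
  right_distrib a b c := LinearMap.map_add₂ _ a b c
  zero_mul := LinearMap.map_zero₂ _
  mul_zero _ := map_zero _

/-- `Z ⊠ (P ⊗ B)` satisfies all identities of `B`. -/
theorem Satisfies.boxTensor_permTensor [Infinite k] {Ω : Type v} (hZ : Z.IsPreCom) (hP : P.IsPerm)
    {B : OmegaAlgebra.{u, v, w} k Ω} {f : Poly k Ω} (hB : B.Satisfies f) :
    (boxTensor Z (permTensor P B)).Satisfies f := by
  let _ : NonUnitalCommRing (Z.carrier ⊗[k] P.carrier) := antiTensorRing hZ hP
  have : IsScalarTower k (Z.carrier ⊗[k] P.carrier) (Z.carrier ⊗[k] P.carrier) :=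
    ⟨fun c a b => LinearMap.map_smul₂ _ c a b⟩
  have : SMulCommClass k (Z.carrier ⊗[k] P.carrier) (Z.carrier ⊗[k] P.carrier) :=
    ⟨fun c a b => (map_smul (antiTensorMul Z P a) c b).symm⟩
  -- A unit is adjoined because scalar extension is defined for unital rings; flatness over `k`
  -- keeps the embedding injective after tensoring with `B`.
  let R := Unitization k (Z.carrier ⊗[k] P.carrier)
  let ι : Z.carrier ⊗[k] P.carrier →ₗ[k] R := Unitization.inrHom k k _
  let φ : Z.carrier ⊗[k] (P.carrier ⊗[k] B.carrier) →ₗ[k] R ⊗[k] B.carrier :=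
    ι.rTensor B.carrier ∘ₗ (TensorProduct.assoc k Z.carrier P.carrier B.carrier).symm.toLinearMap
  refine (hB.extendScalars R).of_injective φ (fun ω a b => ?_) ?_
  · have : (TensorProduct.map₂ Z.mul (TensorProduct.map₂ P.mul (B.op ω)) +
        TensorProduct.map₂ Z.mul.flip (TensorProduct.map₂ P.mul.flip (B.op ω))).compr₂ φ =
        (TensorProduct.map₂ (LinearMap.mul k R) (B.op ω)).compl₁₂ φ φ := by
      refine bilin_ext_triple fun z p a y q b => ?_
      have hι : ∀ a b, ι (antiTensorMul Z P a b) = ι a * ι b := Unitization.inr_mul k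
      simp [φ, TensorProduct.map₂_apply_tmul, ← TensorProduct.add_tmul, ← hι,
        antiTensorMul_tmul]
    exact LinearMap.congr_fun₂ this a b
  · exact (Module.Flat.rTensor_preserves_injective_linearMap ι Unitization.inr_injective).comp
      (TensorProduct.assoc k Z.carrier P.carrier B.carrier).symm.injective

end PermZinbiel

/-! ### Passing from generators to the whole variety. -/

section Free

variable {k : Type u} [Field k] {Ω : Type v}

/-- The product of polynomials in the free algebra. -/
noncomputable def polyOp (ω : Ω) : Poly k Ω →ₗ[k] Poly k Ω →ₗ[k] Poly k Ω :=
  Finsupp.linearCombination k fun s =>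
    Finsupp.linearCombination k fun t => Finsupp.single (Monomial.op ω s t) 1

theorem polyEval_polyOp (A : OmegaAlgebra.{u, v, w} k Ω) (x : ℕ → A.carrier) (ω : Ω)
    (f g : Poly k Ω) :
    polyEval A x (polyOp ω f g) = A.op ω (polyEval A x f) (polyEval A x g) := by
  have : (polyOp ω).compr₂ (polyEval A x) =
      (A.op ω).compl₁₂ (polyEval A x) (polyEval A x) := by
    ext s t
    simp [polyOp, polyEval, Monomial.eval]
  exact LinearMap.congr_fun₂ this f g

/-- The algebra `Z ⊠ F` for the free dialgebra `F`. -/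
noncomputable def boxFree (Z : OmegaAlgebra.{u, 0, w} k Unit) (Ω : Type v) :
    OmegaAlgebra.{u, v, max u v w} k Ω where
  carrier := Z.carrier ⊗[k] Poly k (Ω ⊕ Ω)
  op ω := TensorProduct.map₂ Z.mul (polyOp (Sum.inl ω)) +
    TensorProduct.map₂ Z.mul.flip (polyOp (Sum.inr ω))

/-- A substitution into `D` is a homomorphism from the free dialgebra, and tensoring it with `Z`
respects the box operations. -/
theorem polyEval_boxFree (Z : OmegaAlgebra.{u, 0, max u v w} k Unit)
    (D : Dialgebra.{u, v, max u v w} k Ω)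
    (a : ℕ → D.carrier) (s : ℕ → (boxFree Z Ω).carrier) (f : Poly k Ω) :
    (polyEval D a).lTensor Z.carrier (polyEval (boxFree Z Ω) s f) =
      polyEval (boxTensor Z D) (fun n => (polyEval D a).lTensor Z.carrier (s n)) f := by
  refine map_polyEval (A := boxFree Z Ω) (B := boxTensor Z D) ((polyEval D a).lTensor Z.carrier)
    (fun ω b c => ?_) s f
  refine map_bilin_of_tmul (TensorProduct.map₂ Z.mul (polyOp (Sum.inl ω)) +
    TensorProduct.map₂ Z.mul.flip (polyOp (Sum.inr ω)))
    (TensorProduct.map₂ Z.mul (D.vdash ω) + TensorProduct.map₂ Z.mul.flip (D.dashv ω))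
    ((polyEval D a).lTensor Z.carrier) (fun z g y h => ?_) b c
  simp [TensorProduct.map₂_apply_tmul, polyEval_polyOp, vdash, dashv]

/-- Countably many elements of `Z ⊗ D` lie in the image of `Z ⊗ F` under a substitution. -/
theorem exists_lTensor_polyEval (M : Type w₁) [AddCommGroup M] [Module k M]
    (D : OmegaAlgebra.{u, v, w} k Ω) (x : ℕ → M ⊗[k] D.carrier) :
    ∃ (a : ℕ → D.carrier) (s : ℕ → M ⊗[k] Poly k Ω),
      ∀ n, (polyEval D a).lTensor M (s n) = x n := by
  choose S hS using fun n => TensorProduct.exists_finset (x n)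
  -- Countably many tensors involve only countably many elements of `D`, so the variables suffice to
  -- name them; `0` is added to make the set nonempty.
  have hc : (insert 0 (⋃ n, Prod.snd '' (S n : Set (M × D.carrier)))).Countable :=
    (Set.countable_iUnion fun n => ((S n).finite_toSet.image _).countable).insert 0
  obtain ⟨a, ha⟩ := hc.exists_eq_range (Set.insert_nonempty _ _)
  have hex : ∀ n, ∀ p ∈ S n, ∃ i, a i = p.2 := fun n p hp => by
    rw [← Set.mem_range, ← ha]
    exact Set.mem_insert_of_mem _ (Set.mem_iUnion.2 ⟨n, p, hp, rfl⟩)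
  choose! i hi using hex
  refine ⟨a, fun n => ∑ p ∈ S n, p.1 ⊗ₜ Finsupp.single (.var (i n p)) 1, fun n => ?_⟩
  rw [hS n, map_sum]
  refine Finset.sum_congr rfl fun p hp => ?_
  simp [polyEval, Monomial.eval, hi n p hp]

/-- If a dialgebra `D` satisfies all identities of a class `C`, then `Z ⊠ D` satisfies all
identities that hold on `Z ⊠ E` for every `E` in `C`. -/
theorem Satisfies.boxTensor_of_mem_Var (Z : OmegaAlgebra.{u, 0, max u v w} k Unit)
    {C : Set (Dialgebra.{u, v, max u v w} k Ω)} {D : Dialgebra.{u, v, max u v w} k Ω}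
    (hD : D ∈ Var C) {f : Poly k Ω} (hf : ∀ E ∈ C, (boxTensor Z E).Satisfies f) :
    (boxTensor Z D).Satisfies f := by
  intro x
  obtain ⟨a, s, hs⟩ := exists_lTensor_polyEval Z.carrier D x
  obtain rfl : (fun n => (polyEval D a).lTensor Z.carrier (s n)) = x := funext hs
  refine (polyEval_boxFree Z D a s f).symm.trans ?_
  set t : Z.carrier ⊗[k] Poly k (Ω ⊕ Ω) := polyEval (boxFree Z Ω) s f
  have hcomm : ∀ (E : Dialgebra.{u, v, max u v w} k Ω) (y : ℕ → E.carrier) (φ : Z.carrier →ₗ[k] k)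
      (t : Z.carrier ⊗[k] Poly k (Ω ⊕ Ω)),
      TensorProduct.lid k E.carrier (φ.rTensor _ ((polyEval E y).lTensor Z.carrier t)) =
        polyEval E y (TensorProduct.lid k _ (φ.rTensor _ t)) := by
    intro E y φ t
    induction t with
    | zero => simp
    | add t t' h h' => simp only [map_add, h, h']
    | tmul z g => simp
  refine tensor_eq_zero_of_forall_dual _ fun φ => ?_
  rw [hcomm]
  -- A functional on `Z` turns `t` into a dialgebra polynomial. It is an identity of `C`, since `t`
  -- dies under every substitution into a member of `C`; hence it holds on `D`.
  refine hD _ (fun E hE y => ?_) a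
  have h0 : (polyEval E y).lTensor Z.carrier t = 0 :=
    (polyEval_boxFree Z E y s f).trans (hf E hE _)
  rw [← hcomm, h0, map_zero, map_zero]

end Free

theorem hat_subset_of_subset_di {k : Type u} [Field k] [CharZero k] {Ω : Type v}
    {V : Set (Dialgebra.{u, v, max u v w} k Ω)} {M : Set (OmegaAlgebra.{u, v, max u v w} k Ω)}
    (hM : IsVariety M) (hVM : V ⊆ di M) : hat V ⊆ M := by
  obtain ⟨T, rfl⟩ := hM
  intro B hB f hf
  refine hB f ?_
  rintro _ ⟨Z, A, hZ, hA, rfl⟩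
  refine Satisfies.boxTensor_of_mem_Var.{u, v, w} Z (hVM hA) ?_
  rintro _ ⟨P, E, hP, hE, rfl⟩
  have : Infinite k := Infinite.of_injective _ (Nat.cast_injective (R := k))
  exact Satisfies.boxTensor_permTensor hZ hP (hE f hf)

/-! ### The two test algebras and their functionals. -/

/-- The Perm-algebra with product `p q = ε(p) q` on a two-dimensional space. -/
theorem exists_isPerm (k : Type u) [Field k] :
    ∃ (P : OmegaAlgebra.{u, 0, max u w} k Unit) (ε δ : P.carrier →ₗ[k] k) (p₁ p₂ : P.carrier),
      P.IsPerm ∧ (∀ p q, ε (P.mul p q) = ε p * ε q) ∧ (∀ p q, δ (P.mul p q) = ε p * δ q) ∧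
        ε p₁ = 1 ∧ ε p₂ = 0 ∧ δ p₁ = 0 ∧ δ p₂ = 1 := by
  let e : ULift.{w} (k × k) →ₗ[k] k × k := ULift.moduleEquiv.toLinearMap
  let ε : ULift.{w} (k × k) →ₗ[k] k := LinearMap.fst k k k ∘ₗ e
  let δ : ULift.{w} (k × k) →ₗ[k] k := LinearMap.snd k k k ∘ₗ e
  let P : OmegaAlgebra.{u, 0, max u w} k Unit :=
    { carrier := ULift.{w} (k × k)
      op := fun _ => (LinearMap.lsmul k (ULift.{w} (k × k))).comp ε }
  have hε : ∀ p q : ULift.{w} (k × k), ε (P.mul p q) = ε p * ε q := fun p q => map_smul ε (ε p) q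
  refine ⟨P, ε, δ, ⟨(1, 0)⟩, ⟨(0, 1)⟩, ⟨fun x y z => ?_, fun x y z => ?_⟩, hε,
    fun p q => map_smul δ (ε p) q, rfl, rfl, rfl, rfl⟩
  · exact (congrArg (· • z) (hε x y)).trans (mul_smul (ε x) (ε y) z)
  · rw [map_sub, LinearMap.sub_apply, sub_eq_zero]
    exact congrArg (· • z) ((hε x y).trans ((mul_comm _ _).trans (hε y x).symm))

/-- The integral of a polynomial with zero constant term. -/
noncomputable def polyIntegral (k : Type u) [Field k] : Polynomial k →ₗ[k] Polynomial k :=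
  Polynomial.lsum fun n => ((n + 1 : k)⁻¹) • Polynomial.monomial (n + 1)

theorem polyIntegral_monomial {k : Type u} [Field k] (n : ℕ) (a : k) :
    polyIntegral k (Polynomial.monomial n a) =
      Polynomial.monomial (n + 1) ((n + 1 : k)⁻¹ * a) := by
  simp [polyIntegral, Polynomial.lsum_apply, Polynomial.sum_monomial_index,
    Polynomial.smul_monomial]

/-- The integration operator is a Rota–Baxter operator of weight zero. -/
theorem polyIntegral_mul {k : Type u} [Field k] [CharZero k] (f g : Polynomial k) :
    polyIntegral k (polyIntegral k f * g + polyIntegral k g * f) =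
      polyIntegral k f * polyIntegral k g := by
  induction f using Polynomial.induction_on' with
  | add f f' h h' =>
    simp only [map_add, add_mul, mul_add] at h h' ⊢
    rw [← h, ← h']
    abel
  | monomial m a =>
    induction g using Polynomial.induction_on' with
    | add g g' h h' =>
      simp only [map_add, add_mul, mul_add] at h h' ⊢
      rw [← h, ← h']
      abel
    | monomial n b =>
      have h1 : (m + 1 : k) ≠ 0 := by exact_mod_cast m.succ_ne_zero
      have h2 : (n + 1 : k) ≠ 0 := by exact_mod_cast n.succ_ne_zero
      have h3 : (m + n + 1 + 1 : k) ≠ 0 := by exact_mod_cast (m + n + 1).succ_ne_zero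
      simp only [polyIntegral_monomial, Polynomial.monomial_mul_monomial]
      rw [show n + 1 + m = m + 1 + n by ring, ← map_add, polyIntegral_monomial,
        show m + 1 + n + 1 = m + 1 + (n + 1) by ring]
      congr 1
      push_cast
      rw [show (m + 1 + n + 1 : k) = m + n + 1 + 1 by ring]
      field_simp
      ring

/-- The pre-commutative algebra of polynomials with product `f g = (∫ f) g`, with the functionals
of integration over the unit interval and of evaluation at `1`. -/
theorem exists_isPreCom (k : Type u) [Field k] [CharZero k] :
    ∃ (Z : OmegaAlgebra.{u, 0, max u w} k Unit) (I E : Z.carrier →ₗ[k] k) (z₁ z₂ : Z.carrier),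
      Z.IsPreCom ∧ (∀ z y, E (Z.mul z y) = I z * E y) ∧
        (∀ z y, I (Z.mul z y) + I (Z.mul y z) = I z * I y) ∧ I z₁ = 1 ∧ I z₂ = 0 ∧ E z₂ = 1 := by
  let e : ULift.{w} (Polynomial k) ≃ₗ[k] Polynomial k := ULift.moduleEquiv
  let E₀ : Polynomial k →ₗ[k] k := Polynomial.leval 1
  let J : ULift.{w} (Polynomial k) →ₗ[k] Polynomial k := polyIntegral k ∘ₗ e.toLinearMap
  let Z : OmegaAlgebra.{u, 0, max u w} k Unit :=
    { carrier := ULift.{w} (Polynomial k)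
      op := fun _ => ((LinearMap.mul k (Polynomial k)).compl₁₂ J e.toLinearMap).compr₂
        e.symm.toLinearMap }
  have hmul : ∀ f g : ULift.{w} (Polynomial k), Z.mul f g = e.symm (J f * e g) := fun _ _ => rfl
  have hadd : ∀ f g : ULift.{w} (Polynomial k), J (Z.mul f g) + J (Z.mul g f) = J f * J g := by
    intro f g
    simp only [hmul, J, LinearMap.comp_apply, LinearEquiv.coe_coe, e.apply_symm_apply]
    rw [← map_add, polyIntegral_mul]
  have he : ∀ f g : ULift.{w} (Polynomial k), e (Z.mul f g) = J f * e g := fun f g =>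
    (congrArg e (hmul f g)).trans (e.apply_symm_apply _)
  have h1 : J (e.symm 1) = Polynomial.X := by
    simp only [J, LinearMap.comp_apply, LinearEquiv.coe_coe, e.apply_symm_apply]
    rw [← Polynomial.monomial_zero_one, polyIntegral_monomial]
    simp [Polynomial.monomial_one_one_eq_X]
  -- The witness `z₂ = 2X - 1` has integral `0` over `[0,1]` and value `1` at `1`.
  have h2 : J (e.symm (Polynomial.monomial 1 2 - 1)) = Polynomial.monomial 2 1 - Polynomial.X := by
    rw [map_sub, map_sub, h1]
    simp only [J, LinearMap.comp_apply, LinearEquiv.coe_coe, e.apply_symm_apply]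
    rw [polyIntegral_monomial]
    norm_num
  refine ⟨Z, E₀ ∘ₗ J, E₀ ∘ₗ e.toLinearMap, e.symm 1, e.symm (Polynomial.monomial 1 2 - 1),
    fun x y z => ?_, fun z y => ?_, fun z y => ?_, ?_, ?_, ?_⟩
  · rw [map_add, LinearMap.add_apply]
    apply e.injective
    refine (map_add e _ _).trans ?_
    rw [he, he, ← add_mul, hadd, he, he, mul_assoc]
  · refine (congrArg E₀ (he z y)).trans ?_
    simp [E₀]
  · refine (map_add E₀ _ _).symm.trans ((congrArg E₀ (hadd z y)).trans ?_)
    simp [E₀]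
  · simp [E₀, h1]
  · refine (congrArg E₀ h2).trans ?_
    simp [E₀]
  · simp [E₀]; norm_num

/-! ### Recovering `D` by contraction. -/

section Contract

variable {k : Type u} [Field k] {Ω : Type v}

/-- The elements of a dialgebra on which the operations vanish at their non-central places. -/
def zeroIdeal (D : Dialgebra.{u, v, w} k Ω) : Submodule k D.carrier where
  carrier := {d | ∀ μ z, D.vdash μ d z = 0 ∧ D.dashv μ z d = 0}
  add_mem' ha hb μ z := by simp [ha μ z, hb μ z]
  zero_mem' μ z := by simp
  smul_mem' c d hd μ z := by simp [hd μ z]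

/-- Contraction of the first two factors of a triple tensor product with two functionals. -/
noncomputable def contract {M N L : Type w} [AddCommGroup M] [AddCommGroup N] [AddCommGroup L]
    [Module k M] [Module k N] [Module k L] (θ : M →ₗ[k] k) (φ : N →ₗ[k] k) :
    M ⊗[k] (N ⊗[k] L) →ₗ[k] L :=
  (TensorProduct.lid k L).toLinearMap ∘ₗ
    TensorProduct.map θ ((TensorProduct.lid k L).toLinearMap ∘ₗ φ.rTensor L)

theorem contract_tmul {M N L : Type w} [AddCommGroup M] [AddCommGroup N] [AddCommGroup L]
    [Module k M] [Module k N] [Module k L] (θ : M →ₗ[k] k) (φ : N →ₗ[k] k) (m : M) (n : N)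
    (l : L) : contract θ φ (m ⊗ₜ (n ⊗ₜ l)) = θ m • φ n • l := by
  simp [contract, smul_comm (θ m)]

variable {P Z : OmegaAlgebra.{u, 0, w} k Unit} {D : Dialgebra.{u, v, w} k Ω}
  {I E : Z.carrier →ₗ[k] k} {θ θ₁ θ₂ : P.carrier →ₗ[k] k}
  {μ : P.carrier →ₗ[k] P.carrier →ₗ[k] P.carrier}

/-- `E` splits `zy` as `I(z)E(y)` and `yz` as `E(z)I(y)`, which gives the two summands. The product
`μ` is left general to cover both that of `P` and its flip. -/
theorem contract_eval_op (hE : ∀ z y, E (Z.mul z y) = I z * E y)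
    (hθ : ∀ p q, θ (μ p q) = θ₁ p * θ₂ q) (ω : Ω)
    (a b : P.carrier ⊗[k] (Z.carrier ⊗[k] D.carrier)) :
    contract θ E (TensorProduct.map₂ μ (TensorProduct.map₂ Z.mul (D.vdash ω) +
        TensorProduct.map₂ Z.mul.flip (D.dashv ω)) a b) =
      D.vdash ω (contract θ₁ I a) (contract θ₂ E b) +
        D.dashv ω (contract θ₁ E a) (contract θ₂ I b) := by
  have : (TensorProduct.map₂ μ (TensorProduct.map₂ Z.mul (D.vdash ω) +
      TensorProduct.map₂ Z.mul.flip (D.dashv ω))).compr₂ (contract θ E) =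
      (D.vdash ω).compl₁₂ (contract θ₁ I) (contract θ₂ E) +
        (D.dashv ω).compl₁₂ (contract θ₁ E) (contract θ₂ I) := by
    refine bilin_ext_triple fun p z a q y b => ?_
    simp only [LinearMap.compr₂_apply, TensorProduct.map₂_apply_tmul,
      TensorProduct.map_tmul, LinearMap.add_apply, LinearMap.flip_apply, TensorProduct.tmul_add, map_add, contract_tmul, hθ, hE,
      LinearMap.compl₁₂_apply, map_smul, LinearMap.smul_apply]
    module
  exact LinearMap.congr_fun₂ this a b

/-- Modulo `zeroIdeal` the operations `⊢` and `⊣` agree, so the coefficients `I(zy)` and `I(yz)` add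
up to `I(z)I(y)`. -/
theorem contract_integral_op (hI : ∀ z y, I (Z.mul z y) + I (Z.mul y z) = I z * I y)
    (hθ : ∀ p q, θ (μ p q) = θ₁ p * θ₂ q)
    (hD : ∀ ω a b, D.vdash ω a b - D.dashv ω a b ∈ D.zeroIdeal) (ω : Ω)
    (a b : P.carrier ⊗[k] (Z.carrier ⊗[k] D.carrier)) :
    contract θ I (TensorProduct.map₂ μ (TensorProduct.map₂ Z.mul (D.vdash ω) +
        TensorProduct.map₂ Z.mul.flip (D.dashv ω)) a b) -
      D.vdash ω (contract θ₁ I a) (contract θ₂ I b) ∈ D.zeroIdeal := by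
  have : ((TensorProduct.map₂ μ (TensorProduct.map₂ Z.mul (D.vdash ω) +
      TensorProduct.map₂ Z.mul.flip (D.dashv ω))).compr₂ (contract θ I)).compr₂
        D.zeroIdeal.mkQ =
      ((D.vdash ω).compl₁₂ (contract θ₁ I) (contract θ₂ I)).compr₂ D.zeroIdeal.mkQ := by
    refine bilin_ext_triple fun p z a q y b => ?_
    have hab : D.zeroIdeal.mkQ (D.dashv ω a b) = D.zeroIdeal.mkQ (D.vdash ω a b) :=
      ((Submodule.Quotient.eq _).2 (hD ω a b)).symm
    simp only [LinearMap.compr₂_apply, TensorProduct.map₂_apply_tmul,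
      TensorProduct.map_tmul, LinearMap.add_apply, LinearMap.flip_apply, TensorProduct.tmul_add, map_add, contract_tmul, hθ,
      LinearMap.compl₁₂_apply, map_smul, LinearMap.smul_apply, hab]
    rw [← smul_add, ← add_smul, hI]
    module
  exact (Submodule.Quotient.eq _).1 (LinearMap.congr_fun₂ this a b)

theorem sub_mem_zeroIdeal (hD : D ∈ diAlg₀ k Ω) (ω : Ω) (a b : D.carrier) :
    D.vdash ω a b - D.dashv ω a b ∈ D.zeroIdeal :=
  fun μ z => ⟨(hD ω μ a b z).1, (hD ω μ z a b).2⟩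

/-- Here `a ⊣ b` vanishes, and `a ⊢ b` differs from it by an element of `zeroIdeal`. -/
theorem vdash_mem_zeroIdeal (hD : D ∈ diAlg₀ k Ω) (ω : Ω) (a : D.carrier) {b : D.carrier}
    (hb : b ∈ D.zeroIdeal) : D.vdash ω a b ∈ D.zeroIdeal := by
  have := sub_mem_zeroIdeal hD ω a b
  rwa [(hb ω a).2, sub_zero] at this

theorem vdash_congr_left {a a' : D.carrier} (h : a - a' ∈ D.zeroIdeal) (ω : Ω) (b : D.carrier) :
    D.vdash ω a b = D.vdash ω a' b := by
  have := (h ω b).1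
  rwa [map_sub, LinearMap.sub_apply, sub_eq_zero] at this

theorem dashv_congr_right {b b' : D.carrier} (h : b - b' ∈ D.zeroIdeal) (ω : Ω) (a : D.carrier) :
    D.dashv ω a b = D.dashv ω a b' := by
  have := (h ω a).2
  rwa [map_sub, sub_eq_zero] at this

/-- If `D` satisfies the identities of `di-Alg₀`, then the contraction `δ ⊗ E` takes the values of
monomials in `P ⊗ (Z ⊠ D)` at suitable elements to their values in `D`. -/
theorem contract_monomial_eval (hD : D ∈ diAlg₀ k Ω) {ε δ : P.carrier →ₗ[k] k}
    (hε : ∀ p q, ε (P.mul p q) = ε p * ε q) (hδ : ∀ p q, δ (P.mul p q) = ε p * δ q)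
    (hE : ∀ z y, E (Z.mul z y) = I z * E y)
    (hI : ∀ z y, I (Z.mul z y) + I (Z.mul y z) = I z * I y)
    {x : ℕ → D.carrier} {x' : ℕ → (permTensor P (boxTensor Z D)).carrier}
    (h₁ : ∀ n, contract δ E (x' n) = x n) (h₂ : ∀ n, contract ε I (x' n) = x n)
    (h₃ : ∀ n, contract δ I (x' n) = 0) (m : Monomial (Ω ⊕ Ω)) :
    contract δ E (m.eval _ x') = m.eval D x ∧
      contract ε I (m.eval _ x') - m.eval D x ∈ D.zeroIdeal ∧
        contract δ I (m.eval _ x') ∈ D.zeroIdeal := by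
  -- The claims must be proved together: the `δ ⊗ E` value of a product also involves the `ε ⊗ I`
  -- and `δ ⊗ I` contractions of its factors, each in a place where `zeroIdeal` is annihilated.
  induction m with
  | var n =>
    refine ⟨h₁ n, ?_, ?_⟩
    · exact (congrArg (· ∈ D.zeroIdeal) (sub_eq_zero.2 (h₂ n))).mpr D.zeroIdeal.zero_mem
    · exact (congrArg (· ∈ D.zeroIdeal) (h₃ n)).mpr D.zeroIdeal.zero_mem
  | op ω s t hs ht =>
    obtain ⟨hs₁, hs₂, hs₃⟩ := hs
    obtain ⟨ht₁, ht₂, ht₃⟩ := ht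
    have hD' := sub_mem_zeroIdeal hD
    have hflip : ∀ {θ θ₁ θ₂ : P.carrier →ₗ[k] k}, (∀ p q, θ (P.mul p q) = θ₁ p * θ₂ q) →
        ∀ p q, θ (P.mul.flip p q) = θ₂ p * θ₁ q := fun h p q => (h q p).trans (mul_comm _ _)
    rcases ω with ω | ω
    · refine ⟨?_, ?_, ?_⟩
      · refine (contract_eval_op hE hδ ω _ _).trans ?_
        rw [(ht₃ ω _).2, add_zero, vdash_congr_left hs₂, ht₁]
        rfl
      · have h := contract_integral_op hI hε hD' ω (s.eval _ x') (t.eval _ x')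
        rw [vdash_congr_left hs₂] at h
        have h' := D.zeroIdeal.add_mem h (vdash_mem_zeroIdeal hD ω (s.eval D x) ht₂)
        rw [map_sub, sub_add_sub_cancel] at h'
        exact h'
      · have h := contract_integral_op hI hδ hD' ω (s.eval _ x') (t.eval _ x')
        exact (D.zeroIdeal.sub_mem_iff_left (vdash_mem_zeroIdeal hD ω _ ht₃)).1 h
    · refine ⟨?_, ?_, ?_⟩
      · refine (contract_eval_op hE (hflip hδ) ω _ _).trans ?_
        rw [(hs₃ ω _).1, zero_add, dashv_congr_right ht₂, hs₁]
        rfl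
      · have h := contract_integral_op hI (hflip hε) hD' ω (s.eval _ x') (t.eval _ x')
        rw [vdash_congr_left hs₂] at h
        have h' := D.zeroIdeal.add_mem h (vdash_mem_zeroIdeal hD ω (s.eval D x) ht₂)
        rw [map_sub, sub_add_sub_cancel] at h'
        -- The contraction yields `⊢`; this replaces it by the required `⊣` modulo `zeroIdeal`.
        have h'' := D.zeroIdeal.add_mem h' (hD' ω (s.eval D x) (t.eval D x))
        rw [sub_add_sub_cancel] at h''
        exact h''
      · have h := contract_integral_op hI (hflip hδ) hD' ω (s.eval _ x') (t.eval _ x')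
        rw [(hs₃ ω _).1, sub_zero] at h
        exact h

end Contract

theorem subset_di_hat {k : Type u} [Field k] [CharZero k] {Ω : Type v}
    {V : Set (Dialgebra.{u, v, max u v w} k Ω)} (hV₀ : V ⊆ diAlg₀ k Ω) : V ⊆ di (hat V) := by
  intro D hD f hf x
  obtain ⟨P, ε, δ, p₁, p₂, hP, hε, hδ, h11, h12, h21, h22⟩ := exists_isPerm.{u, max v w} k
  obtain ⟨Z, I, E, z₁, z₂, hZ, hE, hI, hz₁, hz₂, hz₂'⟩ := exists_isPreCom.{u, max v w} k
  have hB : boxTensor Z D ∈ hat V := fun g hg => hg _ ⟨Z, D, hZ, hD, rfl⟩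
  -- On `p₁ ⊗ z₁ + p₂ ⊗ z₂` the functionals `δ ⊗ E` and `ε ⊗ I` are `1` and `δ ⊗ I` is `0`; the
  -- value of `E` at `z₁` is irrelevant because `δ p₁ = 0`.
  let x' : ℕ → P.carrier ⊗[k] (Z.carrier ⊗[k] D.carrier) := fun n =>
    p₁ ⊗ₜ (z₁ ⊗ₜ x n) + p₂ ⊗ₜ (z₂ ⊗ₜ x n)
  have h0 : polyEval (permTensor P (boxTensor Z D)) x' f = 0 := hf _ ⟨P, _, hP, hB, rfl⟩ x'
  have hm := contract_monomial_eval (hV₀ hD) hε hδ hE hI (x := x) (x' := x')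
    (fun n => by simp [x', contract_tmul, *]) (fun n => by simp [x', contract_tmul, *])
    (fun n => by simp [x', contract_tmul, *])
  let φ : (permTensor P (boxTensor Z D)).carrier →ₗ[k] D.carrier := contract δ E
  exact (map_polyEval_of_monomial φ (fun m => (hm m).1) f).symm.trans
    ((congrArg φ h0).trans (map_zero φ))

end OmegaAlgebra

theorem corollary2 {k : Type u} [Field k] [CharZero k] {Ω : Type v}
    (V : Set (OmegaAlgebra.Dialgebra.{u, v, max u v w} k Ω))
    (hV : OmegaAlgebra.IsVariety V) (hV₀ : V ⊆ OmegaAlgebra.diAlg₀ k Ω) :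
    IsLeast {M : Set (OmegaAlgebra.{u, v, max u v w} k Ω) |
        OmegaAlgebra.IsVariety M ∧ V ⊆ OmegaAlgebra.di M}
      (OmegaAlgebra.hat V) :=
  ⟨⟨⟨_, rfl⟩, OmegaAlgebra.subset_di_hat.{u, v, w} hV₀⟩,
    fun _ hM => OmegaAlgebra.hat_subset_of_subset_di.{u, v, w} hM.1 hM.2⟩
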